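/- Let $k$ be a field, let $a,b\ge 1$ be integers with $\gcd(a,b)=1$, let $H=\langle a,b\rangle=\{ia+jb : i,j\in\mathbb Z_{\ge 0}\}$, and let $A=k[[t^a,t^b]]\subseteq k[[t]]$ be the ring of power series with all exponents in $H$, a one-dimensional local domain with maximal ideal $\mathfrak m$. An ideal $I$ of $A$ is an Ulrich ideal if it is $\mathfrak m$-primary, contains a parameter ideal $Q$ (an $\mathfrak m$-primary ideal generated by $\dim A=1$ element) with $I^2=QI$, and $I/I^2$ is a free $A/I$-module. Let $\mathcal X_A^g$ be the set of those Ulrich ideals of $A$ that are generated by monomials in $t$ and are not parameter ideals. If $\mathcal X_A^g\neq\emptyset$, then $a$ or $b$ is even. Every $I\in\mathcal X_A^g$ has the form $I=(t^\alpha,t^\beta)$ with $\alpha,\beta\in H$ and $\alpha<\beta$. Moreover: 1. If $H=\langle 2,2\ell+1\rangle$ with $\ell\ge 0$, then for $\alpha<\beta$ in $H$ one has $(t^\alpha,t^\beta)\in\mathcal X_A^g$ if and only if $\alpha=2q$ for some integer $q$ with $1\le q\le\ell$ and $\beta=2\ell+1$. In this case $\#\mathcal X_A^g=\ell$. 2.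 If $a$ is even and $a>2$, then for $\alpha<\beta$ in $H$ one has, with $c=\beta-\alpha$, that $(t^\alpha,t^\beta)\in\mathcal X_A^g$ if and only if $c=ac'/2$ for some odd integer $c'$ with $1\le c'<b$ and $\alpha=\min\{h\in H : h+c\in H\}$. In this case $\#\mathcal X_A^g=(b-1)/2$. -/

import Mathlib

open IsLocalRing

section LocalRing

variable {A : Type*} [CommRing A] [IsLocalRing A]

/-- A parameter ideal of a local ring of Krull dimension `d`: an ideal primary to the maximal
ideal (its radical is the maximal ideal) that is generated by `d` elements. -/
def IsParameterIdeal (Q : Ideal A) : Prop :=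
  Q.radical = maximalIdeal A ∧
    ∃ (d : ℕ) (x : Fin d → A), ringKrullDim A = d ∧ Ideal.span (Set.range x) = Q

/-- An Ulrich ideal of a (Cohen--Macaulay) local ring `A`: an ideal `I` primary to the maximal
ideal which contains a parameter ideal `Q` with `I ^ 2 = Q I` (so `Q` is a reduction of `I`), and
whose conormal module `I / I ^ 2` is free over `A / I`. -/
def IsUlrichIdeal (I : Ideal A) : Prop :=
  I.radical = maximalIdeal A ∧
    (∃ Q : Ideal A, IsParameterIdeal Q ∧ Q ≤ I ∧ I ^ 2 = Q * I) ∧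
    Module.Free (A ⧸ I) I.Cotangent

end LocalRing

/-- The semigroup ring `k[[H]] ⊆ k[[t]]` of a semigroup `H` of natural numbers: the power series
all of whose exponents lie in `H`. If `H` is generated by `a₁, …, a_ℓ > 0`, this is
`k[[t ^ a₁, …, t ^ a_ℓ]]`; see `mem_semigroupRing_pair` for two generators. -/
def semigroupRing (k : Type*) [Field k] (H : AddSubmonoid ℕ) : Subalgebra k (PowerSeries k) where
  carrier := {f | ∀ n, PowerSeries.coeff n f ≠ 0 → n ∈ H}
  mul_mem' := by
    intro f g hf hg n hn
    rw [PowerSeries.coeff_mul] at hn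
    obtain ⟨p, hp, hne⟩ := Finset.exists_ne_zero_of_sum_ne_zero hn
    rw [← Finset.HasAntidiagonal.mem_antidiagonal.mp hp]
    exact H.add_mem (hf _ (left_ne_zero_of_mul hne)) (hg _ (right_ne_zero_of_mul hne))
  add_mem' := by
    intro f g hf hg n hn
    by_contra h
    apply hn
    rw [map_add, not_not.mp (mt (hf n) h), not_not.mp (mt (hg n) h), add_zero]
  algebraMap_mem' := by
    intro r n hn
    rcases Nat.eq_zero_or_pos n with rfl | hpos
    · exact H.zero_mem
    · exact absurd (by
        rw [PowerSeries.algebraMap_apply, Algebra.algebraMap_self_apply, PowerSeries.coeff_C,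
          if_neg hpos.ne']) hn

/-- `k[[H]]` for `H = ⟨a, b⟩` consists of the power series in `t ^ a` and `t ^ b`, that is of the
sums `∑ c i j * (t ^ a) ^ i * (t ^ b) ^ j`. -/
theorem mem_semigroupRing_pair (k : Type*) [Field k] {a b : ℕ} (ha : 0 < a) (hb : 0 < b)
    (f : PowerSeries k) :
    f ∈ semigroupRing k (AddSubmonoid.closure {a, b}) ↔
      ∃ c : ℕ → ℕ → k, ∀ n, PowerSeries.coeff n f =
        ∑ p ∈ (Finset.range (n + 1) ×ˢ Finset.range (n + 1)).filter
          (fun p => p.1 * a + p.2 * b = n), c p.1 p.2 := by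
  classical
  have key : ∀ n, n ∈ AddSubmonoid.closure ({a, b} : Set ℕ) ↔ ∃ i j : ℕ, i * a + j * b = n := by
    intro n
    rw [AddSubmonoid.mem_closure_pair]
    simp only [smul_eq_mul]
  constructor
  · intro hf
    have h : ∀ n, ∃ p : ℕ × ℕ, PowerSeries.coeff n f ≠ 0 → p.1 * a + p.2 * b = n := by
      intro n
      by_cases h0 : PowerSeries.coeff n f = 0
      · exact ⟨(0, 0), fun h => absurd h0 h⟩
      · obtain ⟨i, j, hij⟩ := (key n).mp (hf n h0)
        exact ⟨(i, j), fun _ => hij⟩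
    choose r hr using h
    refine ⟨fun i j => if (i, j) = r (i * a + j * b) then
      PowerSeries.coeff (i * a + j * b) f else 0, fun n => ?_⟩
    by_cases h0 : PowerSeries.coeff n f = 0
    · rw [h0]
      refine (Finset.sum_eq_zero fun p hp => ?_).symm
      simp only [(Finset.mem_filter.mp hp).2, h0, ite_self]
    · have hrn := hr n h0
      have hmem : r n ∈ (Finset.range (n + 1) ×ˢ Finset.range (n + 1)).filter
          (fun p => p.1 * a + p.2 * b = n) := by
        rw [Finset.mem_filter, Finset.mem_product, Finset.mem_range, Finset.mem_range]
        refine ⟨⟨?_, ?_⟩, hrn⟩ <;> nlinarith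
      rw [Finset.sum_eq_single_of_mem _ hmem]
      · simp only [hrn, if_true]
      · intro p hp hne
        simp only [(Finset.mem_filter.mp hp).2, if_neg hne]
  · rintro ⟨c, hc⟩ n hn
    rw [hc n] at hn
    obtain ⟨p, hp, -⟩ := Finset.exists_ne_zero_of_sum_ne_zero hn
    exact (key n).mpr ⟨p.1, p.2, (Finset.mem_filter.mp hp).2⟩

section SemigroupRing

variable {k : Type*} [Field k] {H : AddSubmonoid ℕ}

theorem semigroupRing_inv_mem {f : PowerSeries k} (hf : f ∈ semigroupRing k H) :
    f⁻¹ ∈ semigroupRing k H := by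
  intro n
  induction n using Nat.strong_induction_on with
  | _ n ih =>
    intro hn
    rw [PowerSeries.coeff_inv] at hn
    split_ifs at hn with h0
    · exact h0 ▸ H.zero_mem
    · obtain ⟨p, hp, hne⟩ := Finset.exists_ne_zero_of_sum_ne_zero (right_ne_zero_of_mul hn)
      split_ifs at hne with hlt
      · rw [← Finset.HasAntidiagonal.mem_antidiagonal.mp hp]
        exact H.add_mem (hf _ (left_ne_zero_of_mul hne)) (ih _ hlt (right_ne_zero_of_mul hne))
      · exact absurd rfl hne

instance semigroupRing_isLocalRing : IsLocalRing (semigroupRing k H) := by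
  have key : ∀ f : semigroupRing k H,
      PowerSeries.constantCoeff (f : PowerSeries k) ≠ 0 → IsUnit f := fun f h =>
    IsUnit.of_mul_eq_one (⟨(f : PowerSeries k)⁻¹, semigroupRing_inv_mem f.2⟩ : semigroupRing k H)
      (Subtype.ext (PowerSeries.mul_inv_cancel _ h))
  refine IsLocalRing.of_isUnit_or_isUnit_one_sub_self fun f => ?_
  by_cases h : PowerSeries.constantCoeff (f : PowerSeries k) = 0
  · right
    apply key
    simp [h]
  · exact Or.inl (key f h)

variable (k) in
/-- The monomial `t ^ h` of `k[[H]]`, for `h ∈ H`. -/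
noncomputable def semigroupRing.monomial (h : H) : semigroupRing k H :=
  ⟨PowerSeries.X ^ (h : ℕ), fun n hn => by
    rw [PowerSeries.coeff_X_pow] at hn
    have hnh : n = (h : ℕ) := by
      by_contra hne
      exact hn (if_neg hne)
    exact hnh ▸ h.2⟩

variable (k H) in
/-- The set of those Ulrich ideals of `A = k[[H]]` that are generated by monomials in `t` and are
not parameter ideals. -/
def monomialUlrichIdeals : Set (Ideal (semigroupRing k H)) :=
  {I | IsUlrichIdeal I ∧ ¬ IsParameterIdeal I ∧
    ∃ S : Set H, I = Ideal.span (semigroupRing.monomial k '' S)}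

end SemigroupRing

/-!
Let `I` be the ideal generated by the monomials with exponents in `S`, and let `E = S + H` be the set
of exponents of the monomials in `I`.

The ring `A = k[[H]]` has dimension one (`ringKrullDim_semigroupRing`), so a reduction of `I` is given
by one element `f` with `I ^ 2 = f I`. Comparing orders, `f` has order `α = min E` and
`E + E ⊆ α + E` (`IsUlrichIdeal.exists_isLeast_add_mem`). Freeness of `I / I ^ 2` says that
generators of `I` which are independent modulo `𝔪 I` satisfy only relations with coefficients in `I`
(`mem_and_mem_of_mul_add_mul_mem_sq`); for monomials, `s + h = s' + h'` with minimal generators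
`s ≠ s'` of `E` forces `h ∈ E` (`IsUlrichIdeal.mem_of_add_eq_add`).

The semigroup `H = ⟨a, b⟩` is symmetric, that is, `A` is Gorenstein. If `F` is its Frobenius number,
every minimal generator `s ≠ α` of `E` satisfies `s + h = F + α` for some `h ∈ H`. With two such
generators, `h ∈ E`, so `F + α ∈ E + E ⊆ α + H`, which is absurd. Hence `I = (t ^ α, t ^ β)`
(`exists_eq_span_pair_of_mem_monomialUlrichIdeals`).

With `c = β - α`, such an ideal is Ulrich and not a parameter ideal if and only if `c ∉ H`, `2 c ∈ H`
and `{h ∈ H | h + c ∈ H} = {α, β} + H` (`span_pair_mem_monomialUlrichIdeals_iff`). Every integer is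
`x a + y b` with unique `x` and `0 ≤ y < a`, and lies in `H` if and only if `0 ≤ x`. For
`c = v b - p a` in this form, the set `{h ∈ H | h + c ∈ H}` is minimally generated by `p a` and
`(a - v) b`, and these two numbers differ by `c` only if `2 v = a` or `2 p = b`
(`exists_of_semigroup_conditions`). If `a` is even, what remains are the pairs
`(α, β) = (u a, a b / 2)` with `0 < u < b / 2`, from which both special cases are read off.
-/

/-! ### Freeness of the conormal module -/

section Conormal

variable {A : Type*} [CommRing A]

/-- If `I / I ^ 2` is free over `A / I`, an element of `I` outside `𝔪 I` has a unit among its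
coordinates. -/
theorem exists_isUnit_apply_toCotangent [IsLocalRing A] {I : Ideal A} (hI : I ≠ ⊤)
    [Module.Free (A ⧸ I) I.Cotangent] (z : I) (hz : (z : A) ∉ maximalIdeal A * I) :
    ∃ φ : I.Cotangent →ₗ[A ⧸ I] A ⧸ I, IsUnit (φ (I.toCotangent z)) := by
  by_contra! hcon
  let e := Module.Free.chooseBasis (A ⧸ I) I.Cotangent
  have hc : ∀ i, ∃ c : A, c ∈ maximalIdeal A ∧
      Ideal.Quotient.mk I c = e.repr (I.toCotangent z) i := by
    intro i
    obtain ⟨c, hc⟩ := Ideal.Quotient.mk_surjective (e.repr (I.toCotangent z) i)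
    refine ⟨c, fun hu => hcon (e.coord i) ?_, hc⟩
    rw [Module.Basis.coord_apply, ← hc]
    exact hu.map _
  choose c hcm hc using hc
  choose w hw using fun i => I.toCotangent_surjective (e i)
  have hsum : I.toCotangent z =
      I.toCotangent (∑ i ∈ (e.repr (I.toCotangent z)).support, c i • w i) := by
    conv_lhs => rw [← e.linearCombination_repr (I.toCotangent z), Finsupp.linearCombination_apply,
      Finsupp.sum]
    rw [map_sum]
    refine Finset.sum_congr rfl fun i _ => ?_
    rw [← hc, map_smul, hw]
    rfl
  have hsub := I.toCotangent_eq.mp hsum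
  have hsq : I ^ 2 ≤ maximalIdeal A * I := by
    rw [pow_two]
    exact Ideal.mul_mono_left (le_maximalIdeal hI)
  have hmem : ((∑ i ∈ (e.repr (I.toCotangent z)).support, c i • w i : I) : A) ∈
      maximalIdeal A * I := by
    rw [Submodule.coe_sum]
    exact Ideal.sum_mem _ fun i _ => Ideal.mul_mem_mul (hcm i) (w i).2
  exact hz (by simpa using add_mem (hsq hsub) hmem)

/-- If `I / I ^ 2` is free over `A / I`, two elements of `I` that are linearly independent modulo
`𝔪 I` are linearly independent over `A / I` in `I / I ^ 2`. -/
theorem mem_and_mem_of_mul_add_mul_mem_sq [IsLocalRing A] {I : Ideal A} (hI : I ≠ ⊤)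
    [Module.Free (A ⧸ I) I.Cotangent] {x y : A} (hx : x ∈ I) (hy : y ∈ I)
    (hxy : ∀ r s, r * x + s * y ∈ maximalIdeal A * I → r ∈ maximalIdeal A ∧ s ∈ maximalIdeal A)
    {r s : A} (h : r * x + s * y ∈ I ^ 2) : r ∈ I ∧ s ∈ I := by
  have hone : (1 : A) ∉ maximalIdeal A := fun h1 =>
    (maximalIdeal.isMaximal A).ne_top ((Ideal.eq_top_iff_one _).mpr h1)
  obtain ⟨φ, hφ⟩ := exists_isUnit_apply_toCotangent hI ⟨x, hx⟩ fun hmem =>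
    hone (hxy 1 0 (by simpa using hmem)).1
  -- Subtract from `y` the multiple of `x` that makes the coordinate `φ` vanish.
  obtain ⟨u, hu⟩ := hφ.exists_left_inv
  obtain ⟨t, ht⟩ := Ideal.Quotient.mk_surjective (φ (I.toCotangent ⟨y, hy⟩) * u)
  have hyx : y - t * x ∈ I := sub_mem hy (I.mul_mem_left t hx)
  have hdec : (⟨y - t * x, hyx⟩ : I) = ⟨y, hy⟩ - t • ⟨x, hx⟩ := rfl
  have hφ0 : φ (I.toCotangent ⟨y - t * x, hyx⟩) = 0 := by
    have hsm : I.toCotangent (t • ⟨x, hx⟩) = Ideal.Quotient.mk I t • I.toCotangent ⟨x, hx⟩ := by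
      rw [map_smul]; rfl
    rw [hdec, map_sub, map_sub, hsm, map_smul, ht, smul_eq_mul, mul_assoc, hu, mul_one,
      sub_self]
  obtain ⟨ψ, hψ⟩ := exists_isUnit_apply_toCotangent hI ⟨y - t * x, hyx⟩ fun hmem =>
    hone (hxy (-t) 1 (by convert hmem using 1; simp only; ring)).2
  have hrel : Ideal.Quotient.mk I (r + s * t) • I.toCotangent ⟨x, hx⟩ +
      Ideal.Quotient.mk I s • I.toCotangent ⟨y - t * x, hyx⟩ = 0 := by
    have : I.toCotangent ((r + s * t) • ⟨x, hx⟩ + s • ⟨y - t * x, hyx⟩) = 0 := by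
      rw [I.toCotangent_eq_zero]
      convert h using 1
      simp only [Submodule.coe_add, Submodule.coe_smul, smul_eq_mul]
      ring
    rw [map_add, map_smul, map_smul] at this
    exact this
  have h1 : Ideal.Quotient.mk I (r + s * t) = 0 := by
    have := congrArg φ hrel
    rw [map_add, map_smul, map_smul, hφ0, smul_zero, add_zero, map_zero, smul_eq_mul] at this
    exact (hφ.mul_left_eq_zero).mp this
  have h2 : Ideal.Quotient.mk I s = 0 := by
    have := congrArg ψ hrel
    rw [h1, zero_smul, zero_add, map_smul, map_zero, smul_eq_mul] at this
    exact (hψ.mul_left_eq_zero).mp this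
  rw [Ideal.Quotient.eq_zero_iff_mem] at h1 h2
  exact ⟨by simpa using sub_mem h1 (I.mul_mem_right t h2), h2⟩

/-- If `I = (x, y)` and the only relations between `x` and `y` modulo `I ^ 2` have coefficients
in `I`, then the classes of `x` and `y` form a basis of `I / I ^ 2`. -/
theorem free_cotangent_span_pair {x y : A}
    (h : ∀ r s, r * x + s * y ∈ Ideal.span {x, y} ^ 2 →
      r ∈ Ideal.span {x, y} ∧ s ∈ Ideal.span {x, y}) :
    Module.Free (A ⧸ Ideal.span {x, y}) (Ideal.span {x, y}).Cotangent := by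
  set I : Ideal A := Ideal.span {x, y} with hI
  have hx : x ∈ I := Ideal.subset_span (by simp)
  have hy : y ∈ I := Ideal.subset_span (by simp)
  have hcomb : ∀ r s : A, Ideal.Quotient.mk I r • I.toCotangent ⟨x, hx⟩ +
      Ideal.Quotient.mk I s • I.toCotangent ⟨y, hy⟩ =
        I.toCotangent (r • ⟨x, hx⟩ + s • ⟨y, hy⟩) := by
    intro r s
    rw [map_add, map_smul, map_smul]
    rfl
  let v : Fin 2 → I.Cotangent := ![I.toCotangent ⟨x, hx⟩, I.toCotangent ⟨y, hy⟩]
  have hli : LinearIndependent (A ⧸ I) v := by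
    rw [LinearIndependent.pair_iff]
    intro r s hrs
    obtain ⟨r, rfl⟩ := Ideal.Quotient.mk_surjective r
    obtain ⟨s, rfl⟩ := Ideal.Quotient.mk_surjective s
    rw [hcomb, I.toCotangent_eq_zero] at hrs
    rw [Ideal.Quotient.eq_zero_iff_mem, Ideal.Quotient.eq_zero_iff_mem]
    exact h r s hrs
  refine Module.Free.of_basis (Module.Basis.mk hli ?_)
  rintro z -
  obtain ⟨⟨z, hz⟩, rfl⟩ := I.toCotangent_surjective z
  obtain ⟨r, s, rfl⟩ := Ideal.mem_span_pair.mp hz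
  have : I.toCotangent ⟨r * x + s * y, hz⟩ = Ideal.Quotient.mk I r • v 0 +
      Ideal.Quotient.mk I s • v 1 := (hcomb r s).symm
  rw [this]
  exact add_mem (Submodule.smul_mem _ _ (Submodule.subset_span ⟨0, rfl⟩))
    (Submodule.smul_mem _ _ (Submodule.subset_span ⟨1, rfl⟩))

end Conormal

/-! ### Monomial ideals of semigroup rings -/

section SemigroupRingIdeals

variable {k : Type*} [Field k] {H : AddSubmonoid ℕ}

/-- The ideal `S + H` of the semigroup `H` generated by `S`. -/
def semigroupIdeal (S : Set H) : Set ℕ :=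
  {n | ∃ s ∈ S, ∃ h ∈ H, n = (s : ℕ) + h}

theorem coe_mem_semigroupIdeal {S : Set H} {s : H} (hs : s ∈ S) : (s : ℕ) ∈ semigroupIdeal S :=
  ⟨s, hs, 0, H.zero_mem, rfl⟩

theorem add_mem_semigroupIdeal {S : Set H} {e h : ℕ} (he : e ∈ semigroupIdeal S) (hh : h ∈ H) :
    e + h ∈ semigroupIdeal S := by
  obtain ⟨s, hs, h', hh', rfl⟩ := he
  exact ⟨s, hs, h' + h, H.add_mem hh' hh, by ring⟩

theorem mem_of_mem_semigroupIdeal {S : Set H} {e : ℕ} (he : e ∈ semigroupIdeal S) : e ∈ H := by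
  obtain ⟨s, -, h, hh, rfl⟩ := he
  exact H.add_mem s.2 hh

theorem mem_semigroupIdeal_pair {α β : H} {n : ℕ} : n ∈ semigroupIdeal {α, β} ↔
    (∃ h ∈ H, n = (α : ℕ) + h) ∨ ∃ h ∈ H, n = (β : ℕ) + h := by
  simp [semigroupIdeal]

theorem coe_monomial (h : H) :
    (semigroupRing.monomial k h : PowerSeries k) = PowerSeries.X ^ (h : ℕ) := rfl

theorem monomial_add (g h : H) : semigroupRing.monomial k (g + h) =
    semigroupRing.monomial k g * semigroupRing.monomial k h :=
  Subtype.ext (pow_add _ _ _)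

theorem coeff_coe_monomial_self (h : H) :
    PowerSeries.coeff (h : ℕ) (semigroupRing.monomial k h : PowerSeries k) ≠ 0 := by
  rw [coe_monomial, PowerSeries.coeff_X_pow_self]
  exact one_ne_zero

theorem monomial_ne_zero (h : H) : semigroupRing.monomial k h ≠ 0 := fun h0 =>
  coeff_coe_monomial_self (k := k) h (by rw [h0]; simp)

theorem mem_maximalIdeal_iff_coeff_zero {f : semigroupRing k H} :
    f ∈ maximalIdeal (semigroupRing k H) ↔ PowerSeries.coeff 0 (f : PowerSeries k) = 0 := by
  rw [mem_maximalIdeal, mem_nonunits_iff, PowerSeries.coeff_zero_eq_constantCoeff_apply]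
  constructor
  · intro h
    by_contra h0
    exact h (IsUnit.of_mul_eq_one
      (⟨(f : PowerSeries k)⁻¹, semigroupRing_inv_mem f.2⟩ : semigroupRing k H)
      (Subtype.ext (PowerSeries.mul_inv_cancel _ h0)))
  · intro h hu
    have := (hu.map (semigroupRing k H).val).map (PowerSeries.constantCoeff (R := k))
    rw [Subalgebra.coe_val, h] at this
    exact not_isUnit_zero this

theorem mem_semigroupIdeal_of_coeff_ne_zero {S : Set H} {f : semigroupRing k H}
    (hf : f ∈ Ideal.span (semigroupRing.monomial k '' S)) {n : ℕ}
    (hn : PowerSeries.coeff n (f : PowerSeries k) ≠ 0) : n ∈ semigroupIdeal S := by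
  induction hf using Submodule.span_induction generalizing n with
  | mem x hx =>
    obtain ⟨s, hs, rfl⟩ := hx
    have hns : n = (s : ℕ) := by
      by_contra hne
      exact hn (by rw [coe_monomial, PowerSeries.coeff_X_pow, if_neg hne])
    exact hns ▸ coe_mem_semigroupIdeal hs
  | zero => exact absurd (by simp) hn
  | add x y _ _ hx hy =>
    by_contra h
    apply hn
    rw [Subalgebra.coe_add, map_add, not_not.mp (mt hx h), not_not.mp (mt hy h), add_zero]
  | smul a x _ hx =>
    rw [smul_eq_mul, Subalgebra.coe_mul, PowerSeries.coeff_mul] at hn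
    obtain ⟨p, hp, hne⟩ := Finset.exists_ne_zero_of_sum_ne_zero hn
    rw [← Finset.HasAntidiagonal.mem_antidiagonal.mp hp, add_comm]
    exact add_mem_semigroupIdeal (hx (right_ne_zero_of_mul hne)) (a.2 _ (left_ne_zero_of_mul hne))

/-- The exponents occurring in elements of `𝔪 I` lie in `E + (H \ {0})`, where `E = S + H`. -/
theorem exists_pos_of_coeff_ne_zero_of_mem_maximalIdeal_mul {S : Set H} {f : semigroupRing k H}
    (hf : f ∈ maximalIdeal (semigroupRing k H) * Ideal.span (semigroupRing.monomial k '' S))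
    {n : ℕ} (hn : PowerSeries.coeff n (f : PowerSeries k) ≠ 0) :
    ∃ e ∈ semigroupIdeal S, ∃ h ∈ H, 0 < h ∧ n = e + h := by
  induction hf using Submodule.mul_induction_on' generalizing n with
  | mem_mul_mem x hx y hy =>
    rw [Subalgebra.coe_mul, PowerSeries.coeff_mul] at hn
    obtain ⟨p, hp, hne⟩ := Finset.exists_ne_zero_of_sum_ne_zero hn
    refine ⟨p.2, mem_semigroupIdeal_of_coeff_ne_zero hy (right_ne_zero_of_mul hne), p.1,
      x.2 _ (left_ne_zero_of_mul hne), Nat.pos_of_ne_zero fun h0 => ?_, ?_⟩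
    · apply left_ne_zero_of_mul hne
      rw [h0]
      exact mem_maximalIdeal_iff_coeff_zero.mp hx
    · rw [← Finset.HasAntidiagonal.mem_antidiagonal.mp hp, add_comm]
  | add x _ y _ hx hy =>
    by_contra h
    apply hn
    rw [Subalgebra.coe_add, map_add, not_not.mp (mt hx h), not_not.mp (mt hy h), add_zero]

theorem monomial_mem_span_iff {S : Set H} {h : H} :
    semigroupRing.monomial k h ∈ Ideal.span (semigroupRing.monomial k '' S) ↔
      (h : ℕ) ∈ semigroupIdeal S := by
  constructor
  · exact fun hm => mem_semigroupIdeal_of_coeff_ne_zero hm (coeff_coe_monomial_self h)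
  · rintro ⟨s, hs, g, hg, hsg⟩
    have : h = ⟨g, hg⟩ + s := Subtype.ext (by simpa [add_comm] using hsg)
    rw [this, monomial_add]
    exact Ideal.mul_mem_left _ _ (Ideal.subset_span ⟨s, hs, rfl⟩)

/-- For two generators, the power series with exponents in `{α, β} + H` form the ideal
`(t ^ α, t ^ β)`. -/
theorem mem_span_pair_of_forall_coeff {α β : H} {f : semigroupRing k H}
    (hf : ∀ n, PowerSeries.coeff n (f : PowerSeries k) ≠ 0 → n ∈ semigroupIdeal {α, β}) :
    f ∈ Ideal.span {semigroupRing.monomial k α, semigroupRing.monomial k β} := by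
  classical
  -- `p` collects the terms of `f` divisible by `t ^ α`, and `q` all the others.
  let p : semigroupRing k H := ⟨PowerSeries.mk fun n =>
    if n ∈ H then PowerSeries.coeff (n + α) (f : PowerSeries k) else 0, fun n hn => by
      rw [PowerSeries.coeff_mk] at hn
      exact (ite_ne_right_iff.mp hn).1⟩
  let q : semigroupRing k H := ⟨PowerSeries.mk fun n =>
    if n ∈ H ∧ ¬ ∃ h ∈ H, n + β = (α : ℕ) + h then
      PowerSeries.coeff (n + β) (f : PowerSeries k) else 0, fun n hn => by
      rw [PowerSeries.coeff_mk] at hn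
      exact (ite_ne_right_iff.mp hn).1.1⟩
  refine Ideal.mem_span_pair.mpr ⟨p, q, Subtype.ext (PowerSeries.ext fun n => ?_)⟩
  rw [Subalgebra.coe_add, Subalgebra.coe_mul, Subalgebra.coe_mul, coe_monomial, coe_monomial,
    map_add, PowerSeries.coeff_mul_X_pow', PowerSeries.coeff_mul_X_pow']
  simp only [p, q, PowerSeries.coeff_mk]
  by_cases hα : ∃ h ∈ H, n = (α : ℕ) + h
  · obtain ⟨h, hh, rfl⟩ := hα
    rw [if_pos (Nat.le_add_right _ _), Nat.add_sub_cancel_left, if_pos hh, add_comm h]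
    split_ifs with h1 h2
    · exact absurd ⟨h, hh, by omega⟩ h2.2
    · rw [add_zero]
    · rw [add_zero]
  · have h1 : (if (α : ℕ) ≤ n then if n - α ∈ H then
        PowerSeries.coeff (n - α + α) (f : PowerSeries k) else 0 else 0) = 0 := by
      split_ifs with h1 h2
      · exact absurd ⟨_, h2, by omega⟩ hα
      · rfl
      · rfl
    rw [h1, zero_add]
    by_cases hn : PowerSeries.coeff n (f : PowerSeries k) = 0
    · split_ifs with h2 h3
      · rw [Nat.sub_add_cancel h2]
      · exact hn.symm
      · exact hn.symm
    · obtain ⟨h, hh, rfl⟩ := (mem_semigroupIdeal_pair.mp (hf n hn)).resolve_left hα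
      rw [if_pos (Nat.le_add_right _ _), Nat.add_sub_cancel_left, add_comm h, if_pos ⟨hh, hα⟩]

/-- Every nonzero ideal of `k[[H]]` contains a power of each element of `𝔪`: since `H` contains all
`n ≥ C`, an element of order `d` divides every power series of order at least `d + C`. -/
theorem pow_mem_span_singleton_of_mem_maximalIdeal {C : ℕ} (hC : ∀ n, C ≤ n → n ∈ H)
    {f g : semigroupRing k H} (hf : f ≠ 0) (hg : g ∈ maximalIdeal (semigroupRing k H)) :
    ∃ N, g ^ N ∈ Ideal.span {f} := by
  have hf' : (f : PowerSeries k) ≠ 0 := fun h => hf (Subtype.ext h)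
  set d := (f : PowerSeries k).order.toNat
  set u := PowerSeries.divXPowOrder (f : PowerSeries k)
  have hfu : PowerSeries.X ^ d * u = (f : PowerSeries k) := PowerSeries.X_pow_order_mul_divXPowOrder
  have hu : PowerSeries.constantCoeff u ≠ 0 := by
    rw [Ne, PowerSeries.constantCoeff_divXPowOrder_eq_zero_iff]
    exact hf'
  have hX : (PowerSeries.X : PowerSeries k) ∣ g := by
    rw [PowerSeries.X_dvd_iff, ← PowerSeries.coeff_zero_eq_constantCoeff_apply]
    exact mem_maximalIdeal_iff_coeff_zero.mp hg
  obtain ⟨w, hw⟩ := pow_dvd_pow_of_dvd hX (d + C)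
  refine ⟨d + C, Ideal.mem_span_singleton'.mpr
    ⟨⟨PowerSeries.X ^ C * (w * u⁻¹), fun n hn => hC n ?_⟩, Subtype.ext ?_⟩⟩
  · by_contra hlt
    exact hn (PowerSeries.X_pow_dvd_iff.mp (Dvd.intro _ rfl) n (not_le.mp hlt))
  · rw [Subalgebra.coe_mul, Subalgebra.coe_pow, hw, ← hfu, pow_add]
    calc PowerSeries.X ^ C * (w * u⁻¹) * (PowerSeries.X ^ d * u)
        = PowerSeries.X ^ d * PowerSeries.X ^ C * w * (u * u⁻¹) := by ring
      _ = PowerSeries.X ^ d * PowerSeries.X ^ C * w := by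
        rw [PowerSeries.mul_inv_cancel _ hu, mul_one]

theorem radical_eq_maximalIdeal {C : ℕ} (hC : ∀ n, C ≤ n → n ∈ H) {I : Ideal (semigroupRing k H)}
    (h0 : I ≠ ⊥) (h1 : I ≠ ⊤) : I.radical = maximalIdeal (semigroupRing k H) := by
  apply le_antisymm (le_maximalIdeal (mt Ideal.radical_eq_top.mp h1))
  obtain ⟨f, hfI, hf⟩ := Submodule.exists_mem_ne_zero_of_ne_bot h0
  intro g hg
  obtain ⟨N, hN⟩ := pow_mem_span_singleton_of_mem_maximalIdeal hC hf hg
  exact ⟨N, (Ideal.span_singleton_le_iff_mem I).mpr hfI hN⟩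

theorem ringKrullDim_semigroupRing {C : ℕ} (hC : ∀ n, C ≤ n → n ∈ H) :
    ringKrullDim (semigroupRing k H) = 1 := by
  refine ringKrullDim_eq_one_iff_of_isLocalRing_isDomain.mpr ⟨?_, fun f hf g hg =>
    pow_mem_span_singleton_of_mem_maximalIdeal hC hf hg⟩
  rw [IsLocalRing.isField_iff_maximalIdeal_eq]
  intro h
  have : semigroupRing.monomial k ⟨C + 1, hC _ (Nat.le_succ C)⟩ ∈
      maximalIdeal (semigroupRing k H) := by
    rw [mem_maximalIdeal_iff_coeff_zero, coe_monomial, PowerSeries.coeff_X_pow,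
      if_neg (Nat.succ_ne_zero C).symm]
  rw [h] at this
  exact monomial_ne_zero _ this

/-- As `k[[H]]` has dimension one, a parameter ideal is a principal ideal primary to `𝔪`. -/
theorem isParameterIdeal_iff {C : ℕ} (hC : ∀ n, C ≤ n → n ∈ H) {Q : Ideal (semigroupRing k H)} :
    IsParameterIdeal Q ↔
      Q.radical = maximalIdeal (semigroupRing k H) ∧ ∃ f, Q = Ideal.span {f} := by
  refine and_congr_right fun _ => ⟨?_, ?_⟩
  · rintro ⟨d, x, hd, rfl⟩
    rw [ringKrullDim_semigroupRing hC] at hd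
    obtain rfl : d = 1 := by exact_mod_cast hd.symm
    exact ⟨x 0, by rw [Set.range_unique]; rfl⟩
  · rintro ⟨f, rfl⟩
    exact ⟨1, fun _ => f, by simpa using ringKrullDim_semigroupRing hC, by
      rw [Set.range_const]⟩

end SemigroupRingIdeals

/-! ### Monomial Ulrich ideals -/

section MonomialUlrichIdeals

variable {k : Type*} [Field k] {H : AddSubmonoid ℕ}

/-- The minimal generators of the ideal `S + H` of the semigroup `H`. -/
def minimalGenerators (S : Set H) : Set ℕ :=
  {s | s ∈ semigroupIdeal S ∧ ∀ e ∈ semigroupIdeal S, ∀ h ∈ H, s = e + h → h = 0}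

theorem exists_minimalGenerators {S : Set H} {e : ℕ} (he : e ∈ semigroupIdeal S) :
    ∃ g ∈ minimalGenerators S, ∃ h ∈ H, e = g + h := by
  induction e using Nat.strong_induction_on with
  | _ e ih =>
    by_cases hg : e ∈ minimalGenerators S
    · exact ⟨e, hg, 0, H.zero_mem, rfl⟩
    · simp only [minimalGenerators, Set.mem_ofPred_eq, not_and, not_forall] at hg
      obtain ⟨e', he', h, hh, heq, h0⟩ := hg he
      obtain ⟨g, hg, h', hh', rfl⟩ := ih e' (by omega) he'
      exact ⟨g, hg, h' + h, H.add_mem hh' hh, by omega⟩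

theorem exists_order_of_mul_eq_X_pow {f g : PowerSeries k} {n : ℕ}
    (h : f * g = PowerSeries.X ^ n) : ∃ i j : ℕ, i + j = n ∧ f.order = i ∧ g.order = j := by
  have hne : f * g ≠ 0 := h ▸ pow_ne_zero n PowerSeries.X_ne_zero
  refine ⟨f.order.toNat, g.order.toNat, ?_,
    (PowerSeries.coe_toNat_order (left_ne_zero_of_mul hne)).symm,
    (PowerSeries.coe_toNat_order (right_ne_zero_of_mul hne)).symm⟩
  have := congrArg PowerSeries.order h
  rw [PowerSeries.order_mul, PowerSeries.order_X_pow,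
    ← PowerSeries.coe_toNat_order (left_ne_zero_of_mul hne),
    ← PowerSeries.coe_toNat_order (right_ne_zero_of_mul hne)] at this
  exact_mod_cast this

theorem ne_top_of_radical_eq_maximalIdeal {A : Type*} [CommRing A] [IsLocalRing A] {I : Ideal A}
    (h : I.radical = maximalIdeal A) : I ≠ ⊤ := by
  rintro rfl
  rw [Ideal.radical_top] at h
  exact (maximalIdeal.isMaximal A).ne_top h.symm

theorem maximalIdeal_semigroupRing_ne_bot {C : ℕ} (hC : ∀ n, C ≤ n → n ∈ H) :
    maximalIdeal (semigroupRing k H) ≠ ⊥ := by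
  rw [Ne, ← IsLocalRing.isField_iff_maximalIdeal_eq]
  exact (ringKrullDim_eq_one_iff_of_isLocalRing_isDomain.mp
    (ringKrullDim_semigroupRing (k := k) hC)).1

/-- If `I ^ 2 = f I` with `f ∈ I`, then `f` has the least order `α` occurring in `I`, and comparing
orders turns this equation into `E + E ⊆ α + E` for `E = S + H`. -/
theorem IsUlrichIdeal.exists_isLeast_add_mem {C : ℕ} (hC : ∀ n, C ≤ n → n ∈ H) {S : Set H}
    (hU : IsUlrichIdeal (Ideal.span (semigroupRing.monomial k '' S))) :
    ∃ α, IsLeast (semigroupIdeal S) α ∧ ∀ e ∈ semigroupIdeal S, ∀ e' ∈ semigroupIdeal S,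
      ∃ e'' ∈ semigroupIdeal S, e + e' = α + e'' := by
  obtain ⟨hrad, ⟨Q, hQ, hQI, hsq⟩, -⟩ := hU
  obtain ⟨-, f, rfl⟩ := (isParameterIdeal_iff hC).mp hQ
  have hfI := (Ideal.span_singleton_le_iff_mem _).mp hQI
  have hne : (semigroupIdeal S).Nonempty := by
    rw [Set.nonempty_iff_ne_empty]
    intro hemp
    have hS : S = ∅ := Set.eq_empty_of_forall_notMem fun s hs => by
      have := coe_mem_semigroupIdeal hs
      rw [hemp] at this
      exact this
    subst hS
    rw [Set.image_empty, Ideal.span_empty, Ideal.radical_bot_of_isReduced] at hrad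
    exact maximalIdeal_semigroupRing_ne_bot hC hrad.symm
  have hprod : ∀ e ∈ semigroupIdeal S, ∀ e' ∈ semigroupIdeal S, ∃ i ∈ semigroupIdeal S,
      ∃ j ∈ semigroupIdeal S, e + e' = i + j ∧ (f : PowerSeries k).order = i := by
    intro e he e' he'
    have hmem := Ideal.mul_mem_mul
      (monomial_mem_span_iff (k := k) (S := S) (h := ⟨e, mem_of_mem_semigroupIdeal he⟩) |>.mpr he)
      (monomial_mem_span_iff (k := k) (S := S) (h := ⟨e', mem_of_mem_semigroupIdeal he'⟩) |>.mpr he')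
    rw [← pow_two, hsq, ← monomial_add, Ideal.mem_span_singleton_mul] at hmem
    obtain ⟨g, hg, hfg⟩ := hmem
    obtain ⟨i, j, hij, hi, hj⟩ := exists_order_of_mul_eq_X_pow (congrArg Subtype.val hfg)
    exact ⟨i, mem_semigroupIdeal_of_coeff_ne_zero hfI (PowerSeries.order_eq_nat.mp hi).1, j,
      mem_semigroupIdeal_of_coeff_ne_zero hg (PowerSeries.order_eq_nat.mp hj).1, hij.symm, hi⟩
  obtain ⟨α, hα⟩ : ∃ α, IsLeast (semigroupIdeal S) α :=
    ⟨_, Nat.sInf_mem hne, fun _ he => Nat.sInf_le he⟩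
  obtain ⟨i, hi, j, hj, hij, hord⟩ := hprod α hα.1 α hα.1
  have hiα : i = α := by
    have := hα.2 hi
    have := hα.2 hj
    omega
  refine ⟨α, hα, fun e he e' he' => ?_⟩
  obtain ⟨i', -, j', hj', hij', hord'⟩ := hprod e he e' he'
  refine ⟨j', hj', ?_⟩
  rw [hij', ← hiα]
  rw [hord] at hord'
  rw [show i = i' by exact_mod_cast hord']

/-- Monomials at distinct minimal generators are linearly independent modulo `𝔪 I`; this gives one of
the two coefficients. -/
theorem mem_maximalIdeal_of_mul_monomial_add_mem {S : Set H} {s s' : H} (hne : s ≠ s')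
    (hs : (s : ℕ) ∈ minimalGenerators S) (hs' : (s' : ℕ) ∈ semigroupIdeal S)
    {r r' : semigroupRing k H}
    (h : r * semigroupRing.monomial k s + r' * semigroupRing.monomial k s' ∈
      maximalIdeal (semigroupRing k H) * Ideal.span (semigroupRing.monomial k '' S)) :
    r ∈ maximalIdeal (semigroupRing k H) := by
  rw [mem_maximalIdeal_iff_coeff_zero]
  by_contra h0
  have hcoeff : PowerSeries.coeff (s : ℕ) ((r * semigroupRing.monomial k s +
      r' * semigroupRing.monomial k s' : semigroupRing k H) : PowerSeries k) ≠ 0 := by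
    rw [Subalgebra.coe_add, Subalgebra.coe_mul, Subalgebra.coe_mul, coe_monomial, coe_monomial,
      map_add, PowerSeries.coeff_mul_X_pow', PowerSeries.coeff_mul_X_pow', if_pos le_rfl,
      Nat.sub_self]
    split_ifs with hle
    · have hz : PowerSeries.coeff ((s : ℕ) - s') (r' : PowerSeries k) = 0 := by
        by_contra hc
        have := hs.2 s' hs' _ (r'.2 _ hc) (by omega)
        exact hne (Subtype.ext (by omega))
      rwa [hz, add_zero]
    · rwa [add_zero]
  obtain ⟨e, he, h, hh, hpos, heq⟩ :=
    exists_pos_of_coeff_ne_zero_of_mem_maximalIdeal_mul h hcoeff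
  exact hpos.ne' (hs.2 e he h hh heq)

/-- A relation `t ^ h * t ^ s = t ^ h' * t ^ s'` between two minimal generators has coefficients in
the ideal `I`, because `I / I ^ 2` is free. -/
theorem IsUlrichIdeal.mem_of_add_eq_add {S : Set H}
    (hU : IsUlrichIdeal (Ideal.span (semigroupRing.monomial k '' S))) {s s' h h' : ℕ}
    (hne : s ≠ s') (hs : s ∈ minimalGenerators S) (hs' : s' ∈ minimalGenerators S)
    (hh : h ∈ H) (hh' : h' ∈ H) (heq : s + h = s' + h') : h ∈ semigroupIdeal S := by
  obtain ⟨hrad, -, hfree⟩ := hU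
  lift s to H using mem_of_mem_semigroupIdeal hs.1
  lift s' to H using mem_of_mem_semigroupIdeal hs'.1
  lift h to H using hh
  lift h' to H using hh'
  have hne' : s ≠ s' := fun h => hne (congrArg _ h)
  have hrel : semigroupRing.monomial k h * semigroupRing.monomial k s +
      (-semigroupRing.monomial k h') * semigroupRing.monomial k s' = 0 := by
    have : semigroupRing.monomial k h * semigroupRing.monomial k s =
        semigroupRing.monomial k h' * semigroupRing.monomial k s' := by
      rw [← monomial_add, ← monomial_add]
      exact congrArg _ (Subtype.ext (by push_cast; omega))
    linear_combination this
  rw [← monomial_mem_span_iff (k := k)]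
  refine (mem_and_mem_of_mul_add_mul_mem_sq (ne_top_of_radical_eq_maximalIdeal hrad)
    (monomial_mem_span_iff.mpr hs.1) (monomial_mem_span_iff.mpr hs'.1) (fun r r' hr => ?_)
    (hrel ▸ Ideal.zero_mem _)).1
  refine ⟨mem_maximalIdeal_of_mul_monomial_add_mem hne' hs hs'.1 hr,
    mem_maximalIdeal_of_mul_monomial_add_mem hne'.symm hs' hs.1 (r' := r) ?_⟩
  rwa [add_comm]

/-- `H` is symmetric with Frobenius number `F`: an integer `x` lies in `H` if and only if `F - x`
does not. The number `F` is an integer since `F = -1` for `H = ℕ`. -/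
def IsSymmetricSemigroup (H : AddSubmonoid ℕ) (F : ℤ) : Prop :=
  ∀ x : ℤ, (∃ h ∈ H, (h : ℤ) = x) ↔ ¬ ∃ h ∈ H, (h : ℤ) = F - x

/-- Over a symmetric semigroup a monomial Ulrich ideal that is not a parameter ideal is generated
by exactly two monomials. The ring `A / (t ^ α)` has a simple socle, spanned by `t ^ (F + α)`, which is a
multiple `t ^ h * t ^ s` of every minimal generator `t ^ s` other than `t ^ α`. If there were two such
generators, freeness would put `t ^ h` into `I`, hence `t ^ (F + α)` into `I ^ 2 = t ^ α I`. -/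
theorem exists_eq_span_pair_of_mem_monomialUlrichIdeals {C : ℕ} (hC : ∀ n, C ≤ n → n ∈ H) {F : ℤ}
    (hF : IsSymmetricSemigroup H F) {I : Ideal (semigroupRing k H)}
    (hI : I ∈ monomialUlrichIdeals k H) : ∃ α β : H, (α : ℕ) < β ∧
      I = Ideal.span {semigroupRing.monomial k α, semigroupRing.monomial k β} := by
  obtain ⟨hU, hpar, S, rfl⟩ := hI
  obtain ⟨α, hα, hadd⟩ := hU.exists_isLeast_add_mem hC
  have hαG : α ∈ minimalGenerators S := ⟨hα.1, fun e he h _ heq => by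
    have := hα.2 he
    omega⟩
  have hFH : ¬ ∃ h ∈ H, (h : ℤ) = F := by
    have := (hF 0).mp ⟨0, H.zero_mem, rfl⟩
    rwa [sub_zero] at this
  have hsocle : ∀ s ∈ minimalGenerators S, s ≠ α → ∃ h ∈ H, ((s + h : ℕ) : ℤ) = F + α := by
    intro s hs hsα
    have hnot : ¬ ∃ h ∈ H, (h : ℤ) = s - α := by
      rintro ⟨h, hh, heq⟩
      have := hs.2 α hα.1 h hh (by omega)
      omega
    obtain ⟨h, hh, heq⟩ := not_not.mp (mt (hF _).mpr hnot)
    exact ⟨h, hh, by push_cast; omega⟩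
  have huniq : ∀ s ∈ minimalGenerators S, ∀ s' ∈ minimalGenerators S, s ≠ α → s' ≠ α →
      s = s' := by
    intro s hs s' hs' hsα hsα'
    by_contra hne
    obtain ⟨h, hh, heq⟩ := hsocle s hs hsα
    obtain ⟨h', hh', heq'⟩ := hsocle s' hs' hsα'
    have hE := hU.mem_of_add_eq_add hne hs hs' hh hh' (by omega)
    obtain ⟨e, he, hse⟩ := hadd s hs.1 h hE
    exact hFH ⟨e, mem_of_mem_semigroupIdeal he, by omega⟩
  by_cases hβ : ∃ β ∈ minimalGenerators S, β ≠ α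
  · obtain ⟨β, hβ, hne⟩ := hβ
    lift α to H using mem_of_mem_semigroupIdeal hα.1
    lift β to H using mem_of_mem_semigroupIdeal hβ.1
    refine ⟨α, β, lt_of_le_of_ne (hα.2 hβ.1) hne.symm, le_antisymm ?_ ?_⟩
    · rw [Ideal.span_le, Set.image_subset_iff]
      intro s hs
      obtain ⟨g, hg, h, hh, heq⟩ := exists_minimalGenerators (coe_mem_semigroupIdeal hs)
      change semigroupRing.monomial k s ∈ Ideal.span _
      rw [← Set.image_pair, monomial_mem_span_iff, mem_semigroupIdeal_pair]
      by_cases hgα : g = α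
      · exact Or.inl ⟨h, hh, hgα ▸ heq⟩
      · exact Or.inr ⟨h, hh, huniq g hg β hβ hgα hne ▸ heq⟩
    · rw [Ideal.span_le]
      rintro _ (rfl | rfl)
      · exact monomial_mem_span_iff.mpr hα.1
      · exact monomial_mem_span_iff.mpr hβ.1
  · refine absurd ?_ hpar
    push Not at hβ
    lift α to H using mem_of_mem_semigroupIdeal hα.1
    refine (isParameterIdeal_iff hC).mpr ⟨hU.1, semigroupRing.monomial k α, le_antisymm ?_ ?_⟩
    · rw [Ideal.span_le, Set.image_subset_iff]
      intro s hs
      obtain ⟨g, hg, h, hh, heq⟩ := exists_minimalGenerators (coe_mem_semigroupIdeal hs)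
      change semigroupRing.monomial k s ∈ Ideal.span _
      rw [← Set.image_singleton, monomial_mem_span_iff]
      exact ⟨α, rfl, h, hh, hβ g hg ▸ heq⟩
    · rw [Ideal.span_singleton_le_iff_mem]
      exact monomial_mem_span_iff.mpr hα.1

/-- If `(t ^ α, t ^ β)` is principal, its generator has order `α`, so the quotient of `t ^ β` by it has
order `β - α`. -/
theorem mem_of_span_pair_eq_span_singleton {α β : H} (hlt : (α : ℕ) < β) {f : semigroupRing k H}
    (hf : Ideal.span {semigroupRing.monomial k α, semigroupRing.monomial k β} =
      Ideal.span {f}) : (β : ℕ) - α ∈ H := by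
  have hle : ∀ n ∈ semigroupIdeal {α, β}, (α : ℕ) ≤ n := by
    intro n hn
    rcases mem_semigroupIdeal_pair.mp hn with ⟨h, -, rfl⟩ | ⟨h, -, rfl⟩ <;> omega
  have hfI : f ∈ Ideal.span (semigroupRing.monomial k '' {α, β}) := by
    rw [Set.image_pair, hf]
    exact Ideal.mem_span_singleton_self f
  have hfac : ∀ g ∈ ({α, β} : Set H), ∃ i j : ℕ, i + j = (g : ℕ) ∧
      j ∈ H ∧ (α : ℕ) ≤ i ∧ (f : PowerSeries k).order = i := by
    intro g hg
    have hmem : semigroupRing.monomial k g ∈ Ideal.span {f} := by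
      rw [← hf, ← Set.image_pair]
      exact Ideal.subset_span ⟨g, hg, rfl⟩
    obtain ⟨r, hr⟩ := Ideal.mem_span_singleton'.mp hmem
    rw [mul_comm] at hr
    obtain ⟨i, j, hij, hi, hj⟩ := exists_order_of_mul_eq_X_pow (congrArg Subtype.val hr)
    exact ⟨i, j, hij, r.2 _ (PowerSeries.order_eq_nat.mp hj).1,
      hle _ (mem_semigroupIdeal_of_coeff_ne_zero hfI (PowerSeries.order_eq_nat.mp hi).1), hi⟩
  obtain ⟨i, j, hij, -, hi, hord⟩ := hfac α (by simp)
  obtain ⟨i', j', hij', hj', hi', hord'⟩ := hfac β (by simp)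
  have : i = i' := by exact_mod_cast hord.symm.trans hord'
  convert hj' using 1
  omega

/-- The ideal `(t ^ α, t ^ (α + c))` is Ulrich and not a parameter ideal if and only if
`H ∪ (c + H)` is a semigroup different from `H`, and `{h ∈ H | h + c ∈ H}` is contained in (hence
equal to) `{α, α + c} + H`. -/
theorem span_pair_mem_monomialUlrichIdeals_iff {C : ℕ} (hC : ∀ n, C ≤ n → n ∈ H) {α β : H}
    {c : ℕ} (hβ : (β : ℕ) = α + c) (hc : 0 < c) :
    Ideal.span {semigroupRing.monomial k α, semigroupRing.monomial k β} ∈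
        monomialUlrichIdeals k H ↔
      c ∉ H ∧ c + c ∈ H ∧ ∀ h ∈ H, h + c ∈ H → h ∈ semigroupIdeal {α, β} := by
  have hαI : semigroupRing.monomial k α ∈
      Ideal.span {semigroupRing.monomial k α, semigroupRing.monomial k β} :=
    Ideal.subset_span (by simp)
  have hβI : semigroupRing.monomial k β ∈
      Ideal.span {semigroupRing.monomial k α, semigroupRing.monomial k β} :=
    Ideal.subset_span (by simp)
  have hlt : (α : ℕ) < β := by omega
  constructor
  · rintro ⟨hU, hpar, -⟩
    have hcH : c ∉ H := by
      intro hcH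
      refine hpar ((isParameterIdeal_iff hC).mpr ⟨hU.1, semigroupRing.monomial k α, ?_⟩)
      have : β = ⟨c, hcH⟩ + α := Subtype.ext (by simp [hβ, add_comm])
      rw [Ideal.span_pair_eq_span_left_iff_dvd, this, monomial_add]
      exact Dvd.intro_left _ rfl
    rw [← Set.image_pair] at hU
    have hmin : ∀ e ∈ semigroupIdeal {α, β}, (α : ℕ) ≤ e := by
      intro e he
      rcases mem_semigroupIdeal_pair.mp he with ⟨h, -, rfl⟩ | ⟨h, -, rfl⟩ <;> omega
    have hαE : (α : ℕ) ∈ semigroupIdeal {α, β} := coe_mem_semigroupIdeal (by simp)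
    have hβE : (β : ℕ) ∈ semigroupIdeal {α, β} := coe_mem_semigroupIdeal (by simp)
    have hαG : (α : ℕ) ∈ minimalGenerators {α, β} := ⟨hαE, fun e he h _ heq => by
      have := hmin e he
      omega⟩
    have hβG : (β : ℕ) ∈ minimalGenerators {α, β} := ⟨hβE, fun e he h hh heq => by
      rcases mem_semigroupIdeal_pair.mp he with ⟨h', hh', rfl⟩ | ⟨h', hh', rfl⟩
      · refine absurd ?_ hcH
        rw [show c = h' + h by omega]
        exact H.add_mem hh' hh
      · omega⟩
    refine ⟨hcH, ?_, fun h hh hhc => ?_⟩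
    · obtain ⟨α', hα', hadd⟩ := hU.exists_isLeast_add_mem hC
      obtain rfl : α' = α := hα'.unique ⟨hαE, hmin⟩
      obtain ⟨e, he, heq⟩ := hadd β hβE β hβE
      rcases mem_semigroupIdeal_pair.mp he with ⟨h, hh, rfl⟩ | ⟨h, hh, rfl⟩
      · rwa [show c + c = h by omega]
      · rw [show h = c by omega] at hh
        exact absurd hh hcH
    · exact hU.mem_of_add_eq_add hlt.ne' hβG hαG hh hhc (by omega)
  · rintro ⟨hcH, hccH, hE⟩
    have hnetop : Ideal.span {semigroupRing.monomial k α, semigroupRing.monomial k β} ≠ ⊤ := by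
      intro htop
      have h0 : semigroupRing.monomial k (0 : H) ∈
          Ideal.span (semigroupRing.monomial k '' {α, β}) := by
        rw [Set.image_pair, htop]
        trivial
      have hα0 : (α : ℕ) = 0 := by
        rcases mem_semigroupIdeal_pair.mp (monomial_mem_span_iff.mp h0) with
          ⟨h, -, heq⟩ | ⟨h, -, heq⟩ <;> rw [ZeroMemClass.coe_zero] at heq <;> omega
      apply hcH
      rw [show c = β by omega]
      exact β.2
    have hnebot : Ideal.span {semigroupRing.monomial k α, semigroupRing.monomial k β} ≠ ⊥ :=
      fun h => monomial_ne_zero (k := k) α (by rwa [h] at hαI)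
    have hrad := radical_eq_maximalIdeal hC hnebot hnetop
    have hαβ : Ideal.span {semigroupRing.monomial k α} ≤
        Ideal.span {semigroupRing.monomial k α, semigroupRing.monomial k β} :=
      (Ideal.span_singleton_le_iff_mem _).mpr hαI
    have hββ : semigroupRing.monomial k β * semigroupRing.monomial k β =
        semigroupRing.monomial k α *
          (semigroupRing.monomial k ⟨c + c, hccH⟩ * semigroupRing.monomial k α) := by
      rw [← monomial_add, ← monomial_add, ← monomial_add]
      congr 1
      exact Subtype.ext (by push_cast; omega)
    have hsq : Ideal.span {semigroupRing.monomial k α, semigroupRing.monomial k β} ^ 2 =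
        Ideal.span {semigroupRing.monomial k α} *
          Ideal.span {semigroupRing.monomial k α, semigroupRing.monomial k β} := by
      refine le_antisymm ?_ (by rw [pow_two]; exact Ideal.mul_mono_left hαβ)
      rw [pow_two, Ideal.mul_le]
      intro x hx y hy
      obtain ⟨r, s, rfl⟩ := Ideal.mem_span_pair.mp hx
      obtain ⟨r', s', rfl⟩ := Ideal.mem_span_pair.mp hy
      rw [Ideal.mem_span_singleton_mul]
      refine ⟨(r * r' + s * s' * semigroupRing.monomial k ⟨c + c, hccH⟩) *
        semigroupRing.monomial k α + (r * s' + s * r') * semigroupRing.monomial k β,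
        add_mem (Ideal.mul_mem_left _ _ hαI) (Ideal.mul_mem_left _ _ hβI), ?_⟩
      linear_combination (- s * s') * hββ
    refine ⟨⟨hrad, ⟨_, ?_, hαβ, hsq⟩, free_cotangent_span_pair fun r s hrs => ?_⟩, ?_,
      {α, β}, by rw [Set.image_pair]⟩
    · refine (isParameterIdeal_iff hC).mpr ⟨radical_eq_maximalIdeal hC ?_ ?_, _, rfl⟩
      · rw [Ne, Ideal.span_singleton_eq_bot]
        exact monomial_ne_zero α
      · exact fun h => hnetop (top_le_iff.mp (h ▸ hαβ))
    · rw [hsq, Ideal.mem_span_singleton_mul] at hrs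
      obtain ⟨w, hw, heq⟩ := hrs
      -- Dividing the relation by `t ^ α` shows that `t ^ c * s` lies in `k[[H]]`.
      have hcancel : (s : PowerSeries k) * PowerSeries.X ^ c =
          ((w - r : semigroupRing k H) : PowerSeries k) := by
        have h1 := congrArg Subtype.val heq
        simp only [Subalgebra.coe_mul, Subalgebra.coe_add, coe_monomial] at h1
        apply mul_left_cancel₀ (pow_ne_zero (α : ℕ) (PowerSeries.X_ne_zero (R := k)))
        rw [hβ, pow_add] at h1
        rw [Subalgebra.coe_sub]
        linear_combination -h1
      have hs : s ∈ Ideal.span {semigroupRing.monomial k α, semigroupRing.monomial k β} := by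
        refine mem_span_pair_of_forall_coeff fun n hn => hE n (s.2 n hn) ((w - r).2 _ ?_)
        rwa [← hcancel, PowerSeries.coeff_mul_X_pow]
      refine ⟨?_, hs⟩
      obtain ⟨p, q, hpq⟩ := Ideal.mem_span_pair.mp hs
      have hwr : w - r = p * semigroupRing.monomial k β +
          q * semigroupRing.monomial k ⟨c + c, hccH⟩ * semigroupRing.monomial k α := by
        refine Subtype.ext ?_
        rw [← hcancel, ← hpq]
        simp only [Subalgebra.coe_mul, Subalgebra.coe_add, coe_monomial, hβ, pow_add]
        ring
      have hwrI : w - r ∈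
          Ideal.span {semigroupRing.monomial k α, semigroupRing.monomial k β} := by
        rw [hwr]
        exact add_mem (Ideal.mul_mem_left _ _ hβI) (Ideal.mul_mem_left _ _ hαI)
      simpa using sub_mem hw hwrI
    · rw [isParameterIdeal_iff hC]
      rintro ⟨-, f, hf⟩
      have := mem_of_span_pair_eq_span_singleton hlt hf
      rw [show (β : ℕ) - α = c by omega] at this
      exact hcH this

end MonomialUlrichIdeals

/-! ### Semigroups with two generators -/

section TwoGenerators

variable {a b : ℕ}

theorem exists_eq_mul_add_mul (ha : 0 < a) (hab : Nat.Coprime a b) (x : ℤ) :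
    ∃ u v : ℤ, 0 ≤ v ∧ v < a ∧ x = u * a + v * b := by
  have hbez : (1 : ℤ) = a * Nat.gcdA a b + b * Nat.gcdB a b := by
    have := Nat.gcd_eq_gcd_ab a b
    rwa [hab.gcd_eq_one, Nat.cast_one] at this
  have ha' : (0 : ℤ) < a := by exact_mod_cast ha
  refine ⟨x * Nat.gcdA a b + (x * Nat.gcdB a b) / a * b, (x * Nat.gcdB a b) % a,
    Int.emod_nonneg _ ha'.ne', Int.emod_lt_of_pos _ ha', ?_⟩
  have := Int.emod_add_mul_ediv (x * Nat.gcdB a b) a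
  linear_combination x * hbez - b * this

/-- Every integer is `u * a + v * b` for unique `u` and `0 ≤ v < a`, and it lies in `⟨a, b⟩` if and
only if `0 ≤ u`. -/
theorem exists_mem_closure_pair_iff (hab : Nat.Coprime a b) {u v x : ℤ}
    (hv : 0 ≤ v) (hva : v < a) (hx : x = u * a + v * b) :
    (∃ h ∈ AddSubmonoid.closure ({a, b} : Set ℕ), (h : ℤ) = x) ↔ 0 ≤ u := by
  constructor
  · rintro ⟨h, hh, rfl⟩
    obtain ⟨i, j, rfl⟩ := (AddSubmonoid.mem_closure_pair ..).mp hh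
    push_cast [smul_eq_mul] at hx
    have hdvd : (a : ℤ) ∣ (j - v) * b := ⟨u - i, by linear_combination hx⟩
    obtain ⟨t, ht⟩ := (Nat.isCoprime_iff_coprime.mpr hab).dvd_of_dvd_mul_right hdvd
    have ha' : (0 : ℤ) < a := by omega
    have ht0 : 0 ≤ t := by
      by_contra! hneg
      nlinarith
    have hu : (a : ℤ) * (u - i - t * b) = 0 := by linear_combination b * ht - hx
    rcases mul_eq_zero.mp hu with h0 | h0
    · omega
    · have : (0 : ℤ) ≤ t * b := by positivity
      omega
  · intro hu
    lift u to ℕ using hu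
    lift v to ℕ using hv
    exact ⟨u * a + v * b, (AddSubmonoid.mem_closure_pair ..).mpr ⟨u, v, rfl⟩, by
      rw [hx]; push_cast; rfl⟩

theorem mem_closure_pair_iff_nonneg (hab : Nat.Coprime a b) {u v : ℤ} {x : ℕ}
    (hv : 0 ≤ v) (hva : v < a) (hx : (x : ℤ) = u * a + v * b) :
    x ∈ AddSubmonoid.closure ({a, b} : Set ℕ) ↔ 0 ≤ u := by
  rw [← exists_mem_closure_pair_iff hab hv hva hx]
  simp

theorem mem_closure_pair_of_le (ha : 0 < a) (hab : Nat.Coprime a b) (n : ℕ) (hn : a * b ≤ n) :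
    n ∈ AddSubmonoid.closure ({a, b} : Set ℕ) := by
  obtain ⟨u, v, hv, hva, hx⟩ := exists_eq_mul_add_mul ha hab n
  rw [mem_closure_pair_iff_nonneg hab hv hva hx]
  have ha' : (0 : ℤ) < a := by exact_mod_cast ha
  have hn' : (a : ℤ) * b ≤ n := by exact_mod_cast hn
  have : v * b ≤ a * b := by gcongr
  by_contra! hneg
  nlinarith

theorem isSymmetricSemigroup_closure_pair (ha : 0 < a) (hab : Nat.Coprime a b) :
    IsSymmetricSemigroup (AddSubmonoid.closure ({a, b} : Set ℕ)) (a * b - a - b) := by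
  intro x
  obtain ⟨u, v, hv, hva, hx⟩ := exists_eq_mul_add_mul ha hab x
  rw [exists_mem_closure_pair_iff hab hv hva hx,
    exists_mem_closure_pair_iff (u := -1 - u) (v := a - 1 - v) hab (by omega) (by omega)
      (by rw [hx]; ring)]
  omega

/-- Write `c = v * b - p * a` with `0 ≤ v < a`. Then `{h ∈ H | h + c ∈ H}` is minimally generated
by `p * a` and `q * b`, where `q = a - v`. These must be `α` and `α + c` in some order, so that
`c = ± (q * b - p * a)`: one sign gives `2 * q = a`, the other `2 * p = b`. -/
theorem exists_of_semigroup_conditions (ha : 0 < a) (hb : 0 < b) (hab : Nat.Coprime a b)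
    {α β : AddSubmonoid.closure ({a, b} : Set ℕ)} {c : ℕ} (hβ : (β : ℕ) = α + c)
    (hc : c ∉ AddSubmonoid.closure ({a, b} : Set ℕ))
    (hcc : c + c ∈ AddSubmonoid.closure ({a, b} : Set ℕ))
    (hE : ∀ h ∈ AddSubmonoid.closure ({a, b} : Set ℕ),
      h + c ∈ AddSubmonoid.closure ({a, b} : Set ℕ) → h ∈ semigroupIdeal {α, β}) :
    (∃ u v : ℕ, 2 * v = a ∧ 0 < u ∧ 2 * u < b ∧ (α : ℕ) = u * a ∧ (β : ℕ) = v * b) ∨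
      2 ∣ b := by
  obtain ⟨u, v, hv, hva, hx⟩ := exists_eq_mul_add_mul ha hab c
  have hu := (mem_closure_pair_iff_nonneg hab hv hva hx).not.mp hc
  have ha' : (0 : ℤ) < a := by exact_mod_cast ha
  -- The normal form of `c + c` has a nonnegative coefficient of `a` only if `a ≤ 2 * v`.
  have hv2 : a ≤ 2 * v ∧ 0 ≤ 2 * u + b := by
    rcases lt_or_ge (2 * v) a with hlt | hge
    · have := (mem_closure_pair_iff_nonneg (x := c + c) (u := 2 * u) (v := 2 * v) hab (by omega)
        hlt (by push_cast; rw [hx]; ring)).mp hcc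
      omega
    · exact ⟨hge, (mem_closure_pair_iff_nonneg (x := c + c) (u := 2 * u + b) (v := 2 * v - a) hab
        (by omega) (by omega) (by push_cast; rw [hx]; ring)).mp hcc⟩
  obtain ⟨p, hp⟩ : ∃ p : ℕ, (p : ℤ) = -u := ⟨(-u).toNat, Int.toNat_of_nonneg (by omega)⟩
  obtain ⟨q, hq⟩ : ∃ q : ℕ, (q : ℤ) = a - v := ⟨(a - v).toNat, Int.toNat_of_nonneg (by omega)⟩
  have hmem : ∀ i j : ℕ, i * a + j * b ∈ AddSubmonoid.closure ({a, b} : Set ℕ) :=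
    fun i j => (AddSubmonoid.mem_closure_pair ..).mpr ⟨i, j, rfl⟩
  have hpa : p * a ∈ AddSubmonoid.closure ({a, b} : Set ℕ) := by simpa using hmem p 0
  have hqb : q * b ∈ AddSubmonoid.closure ({a, b} : Set ℕ) := by simpa using hmem 0 q
  have hpE : p * a ∈ semigroupIdeal {α, β} := hE _ hpa <|
    (mem_closure_pair_iff_nonneg (u := 0) (v := v) hab hv hva
      (by push_cast; rw [hx, hp]; ring)).mpr le_rfl
  have hqE : q * b ∈ semigroupIdeal {α, β} := hE _ hqb <|
    (mem_closure_pair_iff_nonneg (u := b + u) (v := 0) hab le_rfl ha'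
      (by push_cast; rw [hx, hq]; ring)).mpr (by omega)
  -- Both `α` and `β` lie in `{p * a, q * b} + H`.
  have hgen : ∀ h ∈ AddSubmonoid.closure ({a, b} : Set ℕ),
      h + c ∈ AddSubmonoid.closure ({a, b} : Set ℕ) →
      (∃ g ∈ AddSubmonoid.closure ({a, b} : Set ℕ), h = p * a + g) ∨
        ∃ g ∈ AddSubmonoid.closure ({a, b} : Set ℕ), h = q * b + g := by
    intro h hh hhc
    obtain ⟨x, y, hy, hya, hxy⟩ := exists_eq_mul_add_mul ha hab h
    have hx0 := (mem_closure_pair_iff_nonneg hab hy hya hxy).mp hh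
    rcases lt_or_ge (y + v) a with hlt | hge
    · have := (mem_closure_pair_iff_nonneg (u := x + u) (v := y + v) hab (by omega) hlt
        (by push_cast; rw [hx, hxy]; ring)).mp hhc
      left
      obtain ⟨g, hg, heq⟩ := (exists_mem_closure_pair_iff (u := x - p) hab hy hya rfl).mpr (by omega)
      exact ⟨g, hg, by zify; rw [heq, hxy]; ring⟩
    · right
      obtain ⟨g, hg, heq⟩ := (exists_mem_closure_pair_iff (u := x) (v := y - q) hab (by omega)
        (by omega) rfl).mpr hx0
      exact ⟨g, hg, by zify; rw [heq, hxy]; ring⟩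
  have hnpq : ∀ g ∈ AddSubmonoid.closure ({a, b} : Set ℕ), p * a ≠ q * b + g := by
    intro g hg heq
    have := (mem_closure_pair_iff_nonneg (u := p - b) (v := v) hab hv hva
      (by zify at heq; rw [hq] at heq; linear_combination -heq)).mp hg
    omega
  have hnqp : ∀ g ∈ AddSubmonoid.closure ({a, b} : Set ℕ), q * b ≠ p * a + g := by
    intro g hg heq
    rcases hv.eq_or_lt with h0 | hpos
    · omega
    · have := (mem_closure_pair_iff_nonneg (u := -p) (v := q) hab (by omega) (by omega)
        (by zify at heq; linear_combination -heq)).mp hg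
      omega
  have hαgen := hgen α α.2 (hβ ▸ β.2)
  have hβgen := hgen β β.2 (by
    rw [hβ, add_assoc]
    exact AddSubmonoid.add_mem _ α.2 hcc)
  have hnβ : ∀ g ∈ AddSubmonoid.closure ({a, b} : Set ℕ), (β : ℕ) ≠ α + g := by
    intro g hg heq
    rw [show c = g by omega] at hc
    exact hc hg
  -- Mutual divisibility in `H` forces equality, so the two sets of minimal generators agree.
  have hcases : ((α : ℕ) = p * a ∧ (β : ℕ) = q * b) ∨ ((α : ℕ) = q * b ∧ (β : ℕ) = p * a) := by
    rw [mem_semigroupIdeal_pair] at hpE hqE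
    rcases hαgen with ⟨g, hg, hαp⟩ | ⟨g, hg, hαq⟩
    · have hα : (α : ℕ) = p * a := by
        rcases hpE with ⟨g', hg', h'⟩ | ⟨g', hg', h'⟩ <;> omega
      rcases hβgen with ⟨g', hg', hβp⟩ | ⟨g', hg', hβq⟩
      · exact absurd (hα ▸ hβp) (hnβ g' hg')
      · rcases hqE with ⟨g'', hg'', h'⟩ | ⟨g'', hg'', h'⟩
        · exact absurd (hα ▸ h') (hnqp g'' hg'')
        · exact Or.inl ⟨hα, by omega⟩
    · have hα : (α : ℕ) = q * b := by
        rcases hqE with ⟨g', hg', h'⟩ | ⟨g', hg', h'⟩ <;> omega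
      rcases hβgen with ⟨g', hg', hβp⟩ | ⟨g', hg', hβq⟩
      · rcases hpE with ⟨g'', hg'', h'⟩ | ⟨g'', hg'', h'⟩
        · exact absurd (hα ▸ h') (hnpq g'' hg'')
        · exact Or.inr ⟨hα, by omega⟩
      · exact absurd (hα ▸ hβq) (hnβ g' hg')
  rcases hcases with ⟨hαp, hβq⟩ | ⟨hαq, hβp⟩
  · left
    have h1 : (q * b : ℤ) = p * a + c := by exact_mod_cast (by omega : q * b = p * a + c)
    have h2 : (b : ℤ) * (2 * q - a) = 0 := by
      rw [hx] at h1
      linear_combination h1 + b * hq + a * hp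
    have hqa : 2 * (q : ℤ) = a := by
      rcases mul_eq_zero.mp h2 with h | h <;> omega
    refine ⟨p, q, by exact_mod_cast hqa, by omega, ?_, hαp, hβq⟩
    have hpb : 2 * (p : ℤ) ≤ b := by omega
    have hne : 2 * p ≠ b := by
      intro hpb
      have : 2 ∣ Nat.gcd a b := Nat.dvd_gcd ⟨q, by omega⟩ ⟨p, hpb.symm⟩
      rw [hab.gcd_eq_one] at this
      omega
    omega
  · right
    have h1 : (p * a : ℤ) = q * b + c := by exact_mod_cast (by omega : p * a = q * b + c)
    have h2 : (a : ℤ) * (2 * p - b) = 0 := by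
      rw [hx] at h1
      linear_combination h1 + b * hq + a * hp
    exact ⟨p, by rcases mul_eq_zero.mp h2 with h | h <;> omega⟩

theorem semigroup_conditions_of_eq (hab : Nat.Coprime a b)
    {α β : AddSubmonoid.closure ({a, b} : Set ℕ)} {c u v : ℕ} (hβ : (β : ℕ) = α + c)
    (hv : 2 * v = a) (hu : 0 < u) (hub : 2 * u < b) (hα : (α : ℕ) = u * a)
    (hβv : (β : ℕ) = v * b) :
    c ∉ AddSubmonoid.closure ({a, b} : Set ℕ) ∧
      c + c ∈ AddSubmonoid.closure ({a, b} : Set ℕ) ∧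
      ∀ h ∈ AddSubmonoid.closure ({a, b} : Set ℕ),
        h + c ∈ AddSubmonoid.closure ({a, b} : Set ℕ) → h ∈ semigroupIdeal {α, β} := by
  have ha : 0 < a := by
    rcases Nat.eq_zero_or_pos a with rfl | h
    · rw [Nat.coprime_zero_left] at hab
      omega
    · exact h
  have hv' : 2 * (v : ℤ) = a := by exact_mod_cast hv
  have hc : (c : ℤ) = -u * a + v * b := by
    have : (v * b : ℤ) = u * a + c := by exact_mod_cast (by omega : v * b = u * a + c)
    linear_combination -this
  refine ⟨?_, ?_, fun h hh hhc => ?_⟩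
  · rw [mem_closure_pair_iff_nonneg hab (by omega) (by omega) hc]
    omega
  · rw [mem_closure_pair_iff_nonneg (u := b - 2 * u) (v := 0) hab le_rfl (by omega)
      (by push_cast; rw [hc]; linear_combination b * hv')]
    omega
  · obtain ⟨x, y, hy, hya, hxy⟩ := exists_eq_mul_add_mul ha hab h
    have hx0 := (mem_closure_pair_iff_nonneg hab hy hya hxy).mp hh
    rw [mem_semigroupIdeal_pair, hα, hβv]
    rcases lt_or_ge (y + v) a with hlt | hge
    · have := (mem_closure_pair_iff_nonneg (u := x - u) (v := y + v) hab (by omega) hlt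
        (by push_cast; rw [hc, hxy]; ring)).mp hhc
      left
      obtain ⟨g, hg, heq⟩ := (exists_mem_closure_pair_iff (u := x - u) hab hy hya rfl).mpr this
      exact ⟨g, hg, by zify; rw [heq, hxy]; ring⟩
    · right
      obtain ⟨g, hg, heq⟩ := (exists_mem_closure_pair_iff (u := x) (v := y - v) hab (by omega)
        (by omega) rfl).mpr hx0
      exact ⟨g, hg, by zify; rw [heq, hxy]; ring⟩

end TwoGenerators

/-! ### Classification when a generator is even -/

section EvenGenerator

variable {k : Type*} [Field k] {a b : ℕ} {H : AddSubmonoid ℕ}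

/-- For even `a`, the ideals are `(t ^ (u * a), t ^ (a * b / 2))` with `0 < u < b / 2`. -/
theorem span_pair_mem_monomialUlrichIdeals_iff_of_even (ha : 0 < a) (hb : 0 < b)
    (hab : Nat.Coprime a b) (hH : H = AddSubmonoid.closure {a, b}) (hev : Even a) {α β : H}
    (hlt : (α : ℕ) < β) :
    Ideal.span {semigroupRing.monomial k α, semigroupRing.monomial k β} ∈
        monomialUlrichIdeals k H ↔
      ∃ u, 0 < u ∧ 2 * u < b ∧ (α : ℕ) = u * a ∧ 2 * (β : ℕ) = a * b := by
  subst hH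
  have hβ : (β : ℕ) = α + (β - α) := by omega
  rw [span_pair_mem_monomialUlrichIdeals_iff (mem_closure_pair_of_le ha hab) hβ (by omega)]
  constructor
  · rintro ⟨hc, hcc, hE⟩
    rcases exists_of_semigroup_conditions ha hb hab hβ hc hcc hE with
      ⟨u, v, hv, hu, hub, hα, hβv⟩ | h2
    · exact ⟨u, hu, hub, hα, by rw [hβv, ← hv]; ring⟩
    · have := Nat.dvd_gcd hev.two_dvd h2
      rw [hab.gcd_eq_one] at this
      omega
  · rintro ⟨u, hu, hub, hα, h2β⟩
    obtain ⟨v, hv⟩ := hev.two_dvd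
    refine semigroup_conditions_of_eq hab hβ hv.symm hu hub hα ?_
    have : a * b = 2 * (v * b) := by rw [← mul_assoc, ← hv]
    omega

/-- The smaller exponent `α` is determined by the ideal `(t ^ α, t ^ β)`, as its least order. -/
theorem le_of_span_pair_eq_span_pair {α β α' β' : H} (hlt' : (α' : ℕ) < β')
    (h : Ideal.span {semigroupRing.monomial k α, semigroupRing.monomial k β} =
      Ideal.span {semigroupRing.monomial k α', semigroupRing.monomial k β'}) :
    (α' : ℕ) ≤ α := by
  have hmem : semigroupRing.monomial k α ∈ Ideal.span (semigroupRing.monomial k '' {α', β'}) := by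
    rw [Set.image_pair, ← h]
    exact Ideal.subset_span (by simp)
  rcases mem_semigroupIdeal_pair.mp (monomial_mem_span_iff.mp hmem) with
    ⟨g, -, hg⟩ | ⟨g, -, hg⟩ <;> omega

theorem encard_monomialUlrichIdeals_of_even (ha : 0 < a) (hb : 0 < b) (hab : Nat.Coprime a b)
    (hH : H = AddSubmonoid.closure {a, b}) (hev : Even a) :
    (monomialUlrichIdeals k H).encard = ((b - 1) / 2 : ℕ) := by
  obtain ⟨v, hv⟩ := hev.two_dvd
  have hmem : ∀ i j : ℕ, i * a + j * b ∈ H := fun i j =>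
    hH ▸ (AddSubmonoid.mem_closure_pair ..).mpr ⟨i, j, rfl⟩
  let α : ℕ → H := fun u => ⟨u * a, by simpa using hmem u 0⟩
  let β : H := ⟨v * b, by simpa using hmem 0 v⟩
  have hv0 : 0 < v := by omega
  have hαβ : ∀ u, 2 * u < b → (α u : ℕ) < β := by
    intro u hu
    change u * a < v * b
    rw [hv, show u * (2 * v) = v * (2 * u) by ring]
    exact Nat.mul_lt_mul_of_pos_left hu hv0
  let φ : ℕ → Ideal (semigroupRing k H) := fun u =>
    Ideal.span {semigroupRing.monomial k (α u), semigroupRing.monomial k β}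
  have himage : monomialUlrichIdeals k H = φ '' (Finset.Icc 1 ((b - 1) / 2) : Finset ℕ) := by
    ext I
    constructor
    · intro hI
      obtain ⟨α', β', hlt, rfl⟩ := exists_eq_span_pair_of_mem_monomialUlrichIdeals
        (hH ▸ mem_closure_pair_of_le ha hab) (hH ▸ isSymmetricSemigroup_closure_pair ha hab) hI
      obtain ⟨u, hu, hub, hα', hβ'⟩ :=
        (span_pair_mem_monomialUlrichIdeals_iff_of_even ha hb hab hH hev hlt).mp hI
      refine ⟨u, by rw [Finset.mem_coe, Finset.mem_Icc]; omega, ?_⟩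
      rw [show α' = α u from Subtype.ext hα', show β' = β from Subtype.ext ?_]
      change (β' : ℕ) = v * b
      rw [hv, mul_assoc] at hβ'
      omega
    · rintro ⟨u, hu, rfl⟩
      rw [Finset.mem_coe, Finset.mem_Icc] at hu
      exact (span_pair_mem_monomialUlrichIdeals_iff_of_even ha hb hab hH hev
        (hαβ u (by omega))).mpr ⟨u, by omega, by omega, rfl, by
          change 2 * (v * b) = a * b
          rw [hv, mul_assoc]⟩
  have hinj : Set.InjOn φ (Finset.Icc 1 ((b - 1) / 2) : Finset ℕ) := by
    intro u hu u' hu' heq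
    rw [Finset.mem_coe, Finset.mem_Icc] at hu hu'
    exact Nat.eq_of_mul_eq_mul_right ha (le_antisymm
      (le_of_span_pair_eq_span_pair (hαβ u (by omega)) heq.symm)
      (le_of_span_pair_eq_span_pair (hαβ u' (by omega)) heq))
  rw [himage, hinj.encard_image, Set.encard_coe_eq_coe_finsetCard, Nat.card_Icc,
    Nat.add_sub_cancel]

theorem isLeast_of_span_pair_mem_monomialUlrichIdeals {C : ℕ} (hC : ∀ n, C ≤ n → n ∈ H)
    {α β : H} {c : ℕ} (hβ : (β : ℕ) = α + c) (hc : 0 < c)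
    (hI : Ideal.span {semigroupRing.monomial k α, semigroupRing.monomial k β} ∈
      monomialUlrichIdeals k H) :
    IsLeast {h : ℕ | h ∈ H ∧ h + c ∈ H} (α : ℕ) := by
  refine ⟨⟨α.2, hβ ▸ β.2⟩, fun h hh => ?_⟩
  have hE := ((span_pair_mem_monomialUlrichIdeals_iff hC hβ hc).mp hI).2.2 h hh.1 hh.2
  rcases mem_semigroupIdeal_pair.mp hE with ⟨g, -, hg⟩ | ⟨g, -, hg⟩ <;> omega

end EvenGenerator

theorem mainTheorem6 (k : Type*) [Field k] (a b : ℕ) (ha : 0 < a) (hb : 0 < b)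
    (hab : Nat.Coprime a b) (H : AddSubmonoid ℕ) (hH : H = AddSubmonoid.closure {a, b}) :
    -- a monomial nonparameter Ulrich ideal exists only if `a` or `b` is even
    ((monomialUlrichIdeals k H).Nonempty → Even a ∨ Even b) ∧
    -- all these ideals are of the form `(t ^ α, t ^ β)`
    (∀ I ∈ monomialUlrichIdeals k H, ∃ α β : H, (α : ℕ) < β ∧
      I = Ideal.span {semigroupRing.monomial k α, semigroupRing.monomial k β}) ∧
    -- the case `H = ⟨2, 2ℓ + 1⟩`
    (∀ ℓ : ℕ, H = AddSubmonoid.closure {2, 2 * ℓ + 1} →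
      (∀ α β : H, (α : ℕ) < β →
        (Ideal.span {semigroupRing.monomial k α, semigroupRing.monomial k β} ∈
            monomialUlrichIdeals k H ↔
          ∃ q : ℕ, 1 ≤ q ∧ q ≤ ℓ ∧ (α : ℕ) = 2 * q ∧ (β : ℕ) = 2 * ℓ + 1)) ∧
      (monomialUlrichIdeals k H).encard = ℓ) ∧
    -- the case `a > 2` even
    (Even a → 2 < a →
      (∀ α β : H, (α : ℕ) < β →
        (Ideal.span {semigroupRing.monomial k α, semigroupRing.monomial k β} ∈
            monomialUlrichIdeals k H ↔
          ∃ c c' : ℕ, (β : ℕ) = α + c ∧ 2 * c = a * c' ∧ Odd c' ∧ 1 ≤ c' ∧ c' < b ∧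
            IsLeast {h : ℕ | h ∈ H ∧ h + c ∈ H} (α : ℕ))) ∧
      (monomialUlrichIdeals k H).encard = ((b - 1) / 2 : ℕ)) := by
  have hC : ∀ n, a * b ≤ n → n ∈ H := hH ▸ mem_closure_pair_of_le ha hab
  have htwo : ∀ I ∈ monomialUlrichIdeals k H, ∃ α β : H, (α : ℕ) < β ∧
      I = Ideal.span {semigroupRing.monomial k α, semigroupRing.monomial k β} := fun I hI =>
    exists_eq_span_pair_of_mem_monomialUlrichIdeals hC
      (hH ▸ isSymmetricSemigroup_closure_pair ha hab) hI
  refine ⟨?_, htwo, fun ℓ hℓ => ⟨fun α β hlt => ?_, ?_⟩, fun hev h2a => ⟨fun α β hlt => ?_,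
    encard_monomialUlrichIdeals_of_even ha hb hab hH hev⟩⟩
  · rintro ⟨I, hI⟩
    obtain ⟨α, β, hlt, rfl⟩ := htwo I hI
    have hβ : (β : ℕ) = α + (β - α) := by omega
    obtain ⟨hc, hcc, hE⟩ := (span_pair_mem_monomialUlrichIdeals_iff hC hβ (by omega)).mp hI
    subst hH
    rcases exists_of_semigroup_conditions ha hb hab hβ hc hcc hE with ⟨u, v, hv, -⟩ | h2
    · exact Or.inl (even_iff_two_dvd.mpr ⟨v, hv.symm⟩)
    · exact Or.inr (even_iff_two_dvd.mpr h2)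
  · have hcop : Nat.Coprime 2 (2 * ℓ + 1) := by simp
    rw [span_pair_mem_monomialUlrichIdeals_iff_of_even two_pos (Nat.succ_pos _) hcop hℓ even_two hlt]
    constructor
    · rintro ⟨u, hu, hub, hα, hβ⟩
      exact ⟨u, hu, by omega, by omega, by omega⟩
    · rintro ⟨q, hq, hqℓ, hα, hβ⟩
      exact ⟨q, hq, by omega, by omega, by omega⟩
  · have hcop : Nat.Coprime 2 (2 * ℓ + 1) := by simp
    rw [encard_monomialUlrichIdeals_of_even two_pos (Nat.succ_pos _) hcop hℓ even_two]
    congr 1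
    omega
  · have hbodd : Odd b := by
      rw [← Nat.not_even_iff_odd, even_iff_two_dvd]
      intro h2
      have := Nat.dvd_gcd hev.two_dvd h2
      rw [hab.gcd_eq_one] at this
      omega
    constructor
    · intro hI
      obtain ⟨u, hu, hub, hα, hβ⟩ :=
        (span_pair_mem_monomialUlrichIdeals_iff_of_even ha hb hab hH hev hlt).mp hI
      have hβα : (β : ℕ) = α + (β - α) := by omega
      refine ⟨β - α, b - 2 * u, hβα, ?_, ?_, by omega, by omega,
        isLeast_of_span_pair_mem_monomialUlrichIdeals hC hβα (by omega) hI⟩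
      · rw [Nat.mul_sub, Nat.mul_sub, hβ, hα]
        congr 1
        ring
      · rw [Nat.odd_iff] at hbodd ⊢
        omega
    · rintro ⟨c, c', hβ, hc, hodd, hc1, hcb, hleast⟩
      -- The ideal with parameter `u = (b - c') / 2` has the difference `c`, and its smaller
      -- exponent is the least element of the same set as `α`.
      obtain ⟨u, hu⟩ : ∃ u, b = c' + 2 * u := by
        rw [Nat.odd_iff] at hbodd hodd
        exact ⟨(b - c') / 2, by omega⟩
      obtain ⟨v, hv⟩ := hev.two_dvd
      have hmem : ∀ i j : ℕ, i * a + j * b ∈ H := fun i j =>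
        hH ▸ (AddSubmonoid.mem_closure_pair ..).mpr ⟨i, j, rfl⟩
      have hcv : c = v * c' := by
        rw [hv, mul_assoc] at hc
        omega
      have hvb : v * b = u * a + c := by rw [hu, hcv, hv]; ring
      have hcpos : 0 < c := by
        rw [hcv]
        exact Nat.mul_pos (by omega) hc1
      have hI : Ideal.span {semigroupRing.monomial k ⟨u * a, by simpa using hmem u 0⟩,
          semigroupRing.monomial k ⟨v * b, by simpa using hmem 0 v⟩} ∈ monomialUlrichIdeals k H :=
        (span_pair_mem_monomialUlrichIdeals_iff_of_even ha hb hab hH hev (by simp only; omega)).mpr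
          ⟨u, by omega, by omega, rfl, by simp only; rw [hv, mul_assoc]⟩
      have hα := hleast.unique
        (isLeast_of_span_pair_mem_monomialUlrichIdeals hC (by simp only; omega) hcpos hI)
      have hβ' : (β : ℕ) = v * b := by
        simp only at hα
        omega
      convert hI using 4
      · exact Subtype.ext hα
      · exact congrArg _ (Subtype.ext hβ')
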